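/- For a prime $q$, integers $k, N\ge 1$ and $j\in\mathbb F_q^*$, let $\mathsf E_k(N;j,q)$ be the number of quadruples $(u,v,x,y)\in\mathbb F_q^4$ such that $u+v=x+y$ and each of $u^k,v^k,x^k,y^k$ lies in the set $\{j,2j,\dots,Nj\}\subseteq\mathbb F_q$ (integers being reduced modulo $q$). Theorem 1.3. Let $k\ge 3$ be an integer. There are a constant $C>0$ and a function $\delta:\mathbb N\to\mathbb R$ with $\delta(Q)\to 0$ as $Q\to\infty$, both depending only on $k$, such that for all positive integers $Q\ge N\ge 1$ $$\frac{\log Q}{Q}\sum_{\substack{Q/2\le q<Q\\ q\ \text{prime}}}\ \max_{j\in\mathbb F_q^*}\mathsf E_k(N;j,q)\ \le\ C\left(N^2+N^4Q^{-1+\delta(Q)}\right).$$ -/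

import Mathlib

open Filter Topology

/-- `E_k(𝒩; q)`: the number of `(u, v, x, y) ∈ 𝔽_q⁴` with `u + v = x + y` and
`u ^ k, v ^ k, x ^ k, y ^ k ∈ 𝒩`. -/
noncomputable def rootEnergy (k q : ℕ) (S : Set (ZMod q)) : ℕ :=
  Set.ncard {p : ZMod q × ZMod q × ZMod q × ZMod q |
    p.1 + p.2.1 = p.2.2.1 + p.2.2.2 ∧
      p.1 ^ k ∈ S ∧ p.2.1 ^ k ∈ S ∧ p.2.2.1 ^ k ∈ S ∧ p.2.2.2 ^ k ∈ S}

/-- The image of `{j, 2j, …, Nj}` in `𝔽_q`, as a set of residue classes. -/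
def dilatedInterval (N q : ℕ) (j : ZMod q) : Set (ZMod q) :=
  {a | ∃ n : ℕ, 1 ≤ n ∧ n ≤ N ∧ a = j * (n : ZMod q)}

/-- `E_k(N; j, q)`. -/
noncomputable def intervalRootEnergy (k N q : ℕ) (j : ZMod q) : ℕ :=
  rootEnergy k q (dilatedInterval N q j)

/-- The maximum of `E_k(N; j, q)` over `j ∈ 𝔽_q^*`. For prime `q` the index type is finite and
nonempty, so this supremum is a maximum. -/
noncomputable def maxIntervalRootEnergy (k N q : ℕ) : ℕ :=
  ⨆ j : (ZMod q)ˣ, intervalRootEnergy k N q (j : ZMod q)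

/-- The primes `q ∼ Q`, that is, `Q / 2 ≤ q < Q`. -/
def dyadicPrimes (Q : ℕ) : Finset ℕ :=
  (Finset.range Q).filter fun q => q.Prime ∧ Q ≤ 2 * q

/-! Fix radicands `n` in `[1, N]^4` and multiply all values of `x₀ + x₁ - x₂ - x₃` with `x_i ^ k =
n_i`. By Galois invariance and integrality this is an integer, `intResolvent`, and it does not
involve `j`. A solution modulo `q` with `k`-th powers `j * n_i` forces `q` to divide it
(`dvd_intResolvent`), so the maximum over `j` costs nothing. If the integer is nonzero, it is at
most `(4N)^(k^4)` in size, hence has `O_k(1)` prime divisors in the dyadic range; these tuples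
contribute `O_k(N^4)`. If it is zero, a sum of four radicals vanishes, and Kummer theory with
Dedekind independence (`four_radicals_sum_eq_zero`) leaves only pairwise equal radicands or a common
power class: `O(N^2)` tuples, each counted for at most `O(Q / log Q)` primes. Taking `δ = log log Q
/ log Q` turns `log Q / Q` into `Q^(-1+δ)`. -/

/-! ### Kummer theory and vanishing sums of radicals -/

instance isGalois_rat_algebraicClosure : IsGalois ℚ (AlgebraicClosure ℚ) := by
  have h : @IsGalois ℚ _ (AlgebraicClosure ℚ) _ (AlgebraicClosure.instAlgebra ℚ) := inferInstance
  convert h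
  exact Subsingleton.elim _ _

/-- Automorphisms of an algebraic closure of `ℚ` fixing all `M`-th roots of unity. -/
def rootsOfUnityFixing (M : ℕ) : Subgroup (Gal(AlgebraicClosure ℚ/ℚ)) where
  carrier := {σ | ∀ ζ : AlgebraicClosure ℚ, ζ ^ M = 1 → σ ζ = ζ}
  mul_mem' := by
    intro a b ha hb ζ hζ
    rw [AlgEquiv.mul_apply, hb ζ hζ, ha ζ hζ]
  one_mem' := fun ζ _ => rfl
  inv_mem' := by
    intro a ha ζ hζ
    have := ha ζ hζ
    exact (AlgEquiv.symm_apply_eq a).2 this.symm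

theorem div_pow_eq_one_of_pow_eq_rat {M : ℕ} {x : AlgebraicClosure ℚ} (hx : x ≠ 0) {c : ℚ}
    (hc : x ^ M = algebraMap ℚ _ c) (σ : Gal(AlgebraicClosure ℚ/ℚ)) : (σ x / x) ^ M = 1 := by
  have h : (σ x) ^ M = x ^ M := by rw [← map_pow, hc, AlgEquiv.commutes]
  rw [div_pow, h, div_self (pow_ne_zero _ hx)]

/-- There is an automorphism inverting all `M`-th roots of unity. -/
theorem exists_inverting_automorphism {M : ℕ} (hM : 0 < M) :
    ∃ τ : Gal(AlgebraicClosure ℚ/ℚ), (∀ ζ : AlgebraicClosure ℚ, ζ ^ M = 1 → τ ζ = ζ⁻¹) := by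
  have : NeZero M := ⟨hM.ne'⟩
  obtain ⟨ξ, hξ⟩ := HasEnoughRootsOfUnity.exists_primitiveRoot (AlgebraicClosure ℚ) M
  have hconj : IsConjRoot ℚ ξ⁻¹ ξ := by
    rw [isConjRoot_def, ← Polynomial.cyclotomic_eq_minpoly_rat hξ hM,
      ← Polynomial.cyclotomic_eq_minpoly_rat hξ.inv hM]
  obtain ⟨τ, hτ⟩ := (isConjRoot_iff_exists_algEquiv (K := ℚ)).1 hconj
  refine ⟨τ, fun ζ hζ => ?_⟩
  obtain ⟨i, -, rfl⟩ := hξ.eq_pow_of_pow_eq_one hζ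
  rw [map_pow, hτ, inv_pow]

/-- Here `b` lies in the abelian field `ℚ(μ_M)`, so the inverting `τ` commutes with every `σ` on
`b`. If `σ` scales `b` by a root of unity `ε`, it scales `τ b` by `ε⁻¹`; thus `b * τ b` is rational,
with `M`-th power `c ^ 2`. -/
theorem exists_rat_pow_eq_sq {M : ℕ} (hM : 0 < M) {b : AlgebraicClosure ℚ} (hb : b ≠ 0) {c : ℚ}
    (hc : b ^ M = algebraMap ℚ _ c) (hfix : ∀ σ ∈ rootsOfUnityFixing M, σ b = b) :
    ∃ γ : ℚ, γ ^ M = c ^ 2 := by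
  obtain ⟨τ, hτ⟩ := exists_inverting_automorphism hM
  have hcomm : ∀ σ : Gal(AlgebraicClosure ℚ/ℚ), σ (τ b) = τ (σ b) := by
    intro σ
    have hmem : (τ * σ)⁻¹ * (σ * τ) ∈ rootsOfUnityFixing M := by
      intro ζ hζ
      have h1 : (σ ζ) ^ M = 1 := by rw [← map_pow, hζ, map_one]
      have : (σ * τ) ζ = (τ * σ) ζ := by
        rw [AlgEquiv.mul_apply, AlgEquiv.mul_apply, hτ ζ hζ, hτ _ h1, map_inv₀]
      rw [AlgEquiv.mul_apply, this, ← AlgEquiv.mul_apply, inv_mul_cancel, AlgEquiv.one_apply]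
    have h := congrArg (τ * σ) (hfix _ hmem)
    rw [← AlgEquiv.mul_apply, mul_inv_cancel_left] at h
    simpa [AlgEquiv.mul_apply] using h
  obtain ⟨γ, hγ⟩ : b * τ b ∈ Set.range (algebraMap ℚ (AlgebraicClosure ℚ)) := by
    rw [InfiniteGalois.mem_range_algebraMap_iff_fixed]
    intro σ
    set ε := σ b / b with hε
    have hεM := div_pow_eq_one_of_pow_eq_rat hb hc σ
    have hσ : σ b = ε * b := by rw [hε, div_mul_cancel₀ _ hb]
    have hε0 : ε ≠ 0 := by rintro h; rw [← hε, h, zero_pow hM.ne'] at hεM; exact zero_ne_one hεM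
    rw [map_mul, hcomm, hσ, map_mul, hτ ε hεM]
    field_simp
  refine ⟨γ, (algebraMap ℚ (AlgebraicClosure ℚ)).injective ?_⟩
  rw [map_pow, hγ, mul_pow, ← map_pow, hc, AlgEquiv.commutes, map_pow, sq]

/-- The Kummer character `σ ↦ σ x / x` of a radical `x`. -/
noncomputable def kummerCharacter (M : ℕ) (x : AlgebraicClosure ℚ) (hx : x ≠ 0) (c : ℚ)
    (hc : x ^ M = algebraMap ℚ _ c) : rootsOfUnityFixing M →* AlgebraicClosure ℚ where
  toFun σ := σ.1 x / x
  map_one' := by simp [hx]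
  map_mul' σ τ := by
    have h := σ.2 _ (div_pow_eq_one_of_pow_eq_rat hx hc τ.1)
    have h0 : σ.1 x ≠ 0 := by simpa using hx
    rw [map_div₀] at h
    rw [Subgroup.coe_mul, AlgEquiv.mul_apply, ← h, mul_comm, div_mul_div_cancel₀ h0]

/-- Dedekind independence, for families with repetitions. -/
theorem sum_fiber_eq_zero_of_sum_smul_monoidHom_eq_zero {G L ι : Type*} [Monoid G] [CommRing L]
    [IsDomain L] [Fintype ι] (χ : ι → (G →* L)) [DecidableEq (G →* L)] (a : ι → L)
    (h : ∀ g, ∑ i, a i * χ i g = 0) (ψ : G →* L) :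
    ∑ i with χ i = ψ, a i = 0 := by
  classical
  have hli := linearIndependent_monoidHom G L
  rw [linearIndependent_iff'] at hli
  by_cases hψ : ψ ∈ Finset.univ.image χ
  · refine hli (Finset.univ.image χ) (fun φ => ∑ i with χ i = φ, a i) ?_ ψ hψ
    funext g
    rw [Finset.sum_apply, Pi.zero_apply, ← h g,
      ← Finset.sum_fiberwise_of_maps_to (s := Finset.univ) (t := Finset.univ.image χ) (g := χ)
        (fun i _ => Finset.mem_image_of_mem _ (Finset.mem_univ i))]
    refine Finset.sum_congr rfl fun φ _ => ?_
    rw [Pi.smul_apply, smul_eq_mul, Finset.sum_mul]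
    refine Finset.sum_congr rfl fun i hi => ?_
    rw [(Finset.mem_filter.1 hi).2]
  · rw [Finset.filter_eq_empty_iff.2, Finset.sum_empty]
    intro i _ hi
    exact hψ (Finset.mem_image.2 ⟨i, Finset.mem_univ _, hi⟩)

/-- A vanishing sum of four radicals either cancels in pairs, or the squares of the ratios of its
radicands are perfect powers. -/
theorem four_radicals_sum_eq_zero {M : ℕ} (hM : 0 < M) (a : Fin 4 → AlgebraicClosure ℚ)
    (ha : ∀ i, a i ≠ 0) (c : Fin 4 → ℚ) (hc : ∀ i, a i ^ M = algebraMap ℚ _ (c i))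
    (hsum : a 0 + a 1 + a 2 + a 3 = 0) :
    (a 0 + a 1 = 0 ∧ a 2 + a 3 = 0) ∨ (a 0 + a 2 = 0 ∧ a 1 + a 3 = 0) ∨
      (a 0 + a 3 = 0 ∧ a 1 + a 2 = 0) ∨ ∀ i, ∃ γ : ℚ, γ ^ M = (c i / c 0) ^ 2 := by
  classical
  set χ : Fin 4 → (rootsOfUnityFixing M →* AlgebraicClosure ℚ) :=
    fun i => kummerCharacter M (a i) (ha i) (c i) (hc i) with hχ
  have hrel : ∀ g, ∑ i, a i * χ i g = 0 := by
    intro g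
    have : ∀ i, a i * χ i g = g.1 (a i) := fun i => mul_div_cancel₀ _ (ha i)
    simp_rw [this]
    rw [← map_sum, Fin.sum_univ_four, hsum, map_zero]
  have hfib := sum_fiber_eq_zero_of_sum_smul_monoidHom_eq_zero χ a hrel (χ 0)
  simp only [Finset.sum_filter, Fin.sum_univ_four, if_true] at hfib
  have h1 := ha 1
  have h2 := ha 2
  have h3 := ha 3
  have h0 := ha 0
  -- The terms sharing the character of `a 0` sum to zero. One or three such terms would make some
  -- `a i` vanish, two give a pairing, and four make every `a i / a 0` fixed by `rootsOfUnityFixing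
  -- M`.
  by_cases e1 : χ 1 = χ 0 <;> by_cases e2 : χ 2 = χ 0 <;> by_cases e3 : χ 3 = χ 0 <;>
    simp only [e1, e2, e3, if_true, if_false, add_zero] at hfib
  · refine Or.inr (Or.inr (Or.inr fun i => ?_))
    have hi : χ i = χ 0 := by fin_cases i <;> first | rfl | assumption
    refine exists_rat_pow_eq_sq hM (div_ne_zero (ha i) h0) (c := c i / c 0) ?_ ?_
    · rw [div_pow, hc, hc, map_div₀]
    · intro σ hσ
      have := DFunLike.congr_fun hi ⟨σ, hσ⟩
      change σ (a i) / a i = σ (a 0) / a 0 at this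
      have hs : σ (a 0) ≠ 0 := by simpa using h0
      rw [map_div₀, div_eq_div_iff hs h0]
      rw [div_eq_div_iff (ha i) h0] at this
      rw [this, mul_comm]
  all_goals first
    | exact absurd hfib h0
    | (exfalso; first
        | exact h1 (by linear_combination hsum - hfib)
        | exact h2 (by linear_combination hsum - hfib)
        | exact h3 (by linear_combination hsum - hfib))
    | exact Or.inl ⟨hfib, by linear_combination hsum - hfib⟩
    | exact Or.inr (Or.inl ⟨hfib, by linear_combination hsum - hfib⟩)
    | exact Or.inr (Or.inr (Or.inl ⟨hfib, by linear_combination hsum - hfib⟩))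

/-! ### Power classes of the radicands -/

/-- `m` and `n` have the same class modulo `l`-th powers. -/
def SamePowerClass (l m n : ℕ) : Prop := ∀ p, m.factorization p ≡ n.factorization p [MOD l]

/-- `k / gcd (k, 2)`. -/
def reducedExponent (k : ℕ) : ℕ := k / k.gcd 2

theorem two_le_reducedExponent {k : ℕ} (hk : 3 ≤ k) : 2 ≤ reducedExponent k := by
  unfold reducedExponent
  rcases Nat.even_or_odd k with h | h
  · rw [Nat.gcd_eq_right h.two_dvd]; obtain ⟨t, rfl⟩ := h; omega
  · rw [Nat.Coprime.gcd_eq_one (Nat.coprime_two_right.2 h)]; omega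

theorem samePowerClass_of_rat_pow {k m n : ℕ} (hk : 0 < k) (hm : m ≠ 0) (hn : n ≠ 0) {γ : ℚ}
    (h : γ ^ (2 * k) = ((m : ℚ) ^ 2 / (n : ℚ) ^ 2) ^ 2) :
    SamePowerClass (reducedExponent k) m n := by
  intro p
  by_cases hp : p.Prime
  swap
  · rw [Nat.factorization_eq_zero_of_not_prime _ hp, Nat.factorization_eq_zero_of_not_prime _ hp]
  have := Fact.mk hp
  have hm' : (m : ℚ) ≠ 0 := by exact_mod_cast hm
  have hn' : (n : ℚ) ≠ 0 := by exact_mod_cast hn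
  have hv := congrArg (padicValRat p) h
  rw [padicValRat.pow, padicValRat.pow, padicValRat.div (by positivity)
    (by positivity), padicValRat.pow, padicValRat.pow, padicValRat.of_nat,
    padicValRat.of_nat, ← Nat.factorization_def m hp, ← Nat.factorization_def n hp] at hv
  push_cast at hv
  rw [← Int.natCast_modEq_iff, Int.modEq_comm, Int.modEq_iff_dvd]
  have hd : (k : ℤ) ∣ 2 * ((m.factorization p : ℤ) - n.factorization p) :=
    ⟨padicValRat p γ, by linarith⟩
  unfold reducedExponent
  rcases Nat.even_or_odd k with he | ho
  · rw [Nat.gcd_eq_right he.two_dvd]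
    obtain ⟨t, rfl⟩ := he
    obtain ⟨z, hz⟩ := hd
    rw [show (t + t) / 2 = t by omega]
    push_cast at hz
    exact ⟨z, by linarith⟩
  · have hcop := Nat.coprime_two_right.2 ho
    rw [hcop.gcd_eq_one, Nat.div_one]
    have hcop' : IsCoprime (k : ℤ) 2 := by exact_mod_cast Nat.isCoprime_iff_coprime.2 hcop
    exact hcop'.dvd_of_dvd_mul_left hd

/-- The vanishing of a sum of four radicals, in terms of the radicands. -/
theorem radicands_of_sum_eq_zero {k : ℕ} (hk : 0 < k) (n : Fin 4 → ℕ) (hn : ∀ i, n i ≠ 0)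
    (x : Fin 4 → AlgebraicClosure ℚ) (hx : ∀ i, x i ^ k = n i) (h : x 0 + x 1 - x 2 - x 3 = 0) :
    (n 0 = n 1 ∧ n 2 = n 3) ∨ (n 0 = n 2 ∧ n 1 = n 3) ∨ (n 0 = n 3 ∧ n 1 = n 2) ∨
      ∀ i, SamePowerClass (reducedExponent k) (n i) (n 0) := by
  have hx0 : ∀ i, x i ≠ 0 := fun i hi => hn i (by
    have := hx i
    rw [hi, zero_pow hk.ne'] at this
    exact_mod_cast this.symm)
  set a : Fin 4 → AlgebraicClosure ℚ := ![x 0, x 1, -x 2, -x 3] with ha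
  have ha2 : ∀ i, a i ^ 2 = x i ^ 2 := by intro i; fin_cases i <;> simp [ha]
  have haM : ∀ i, a i ^ (2 * k) = (n i : AlgebraicClosure ℚ) ^ 2 := by
    intro i; rw [pow_mul, ha2, ← pow_mul, mul_comm, pow_mul, hx]
  have ha0 : ∀ i, a i ≠ 0 := by intro i; fin_cases i <;> simp [ha, hx0]
  have hpair : ∀ i j, a i + a j = 0 → n i = n j := by
    intro i j hij
    have h1 : a i = - a j := by linear_combination hij
    have h2 := haM i
    rw [h1, pow_mul, neg_sq, ← pow_mul, haM j] at h2
    have h3 : n j ^ 2 = n i ^ 2 := by exact_mod_cast h2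
    exact (Nat.pow_left_injective (n := 2) (by norm_num) h3).symm
  have hs : a 0 + a 1 + a 2 + a 3 = 0 := by
    simp only [ha, Matrix.cons_val]; linear_combination h
  -- The exponent `2 * k` absorbs the signs of `-x 2` and `-x 3`.
  rcases four_radicals_sum_eq_zero (M := 2 * k) (by omega) a ha0 (fun i => (n i : ℚ) ^ 2)
    (fun i => by rw [haM]; simp) hs with h | h | h | h
  · exact Or.inl ⟨hpair _ _ h.1, hpair _ _ h.2⟩
  · exact Or.inr (Or.inl ⟨hpair _ _ h.1, hpair _ _ h.2⟩)
  · exact Or.inr (Or.inr (Or.inl ⟨hpair _ _ h.1, hpair _ _ h.2⟩))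
  · refine Or.inr (Or.inr (Or.inr fun i => ?_))
    obtain ⟨γ, hγ⟩ := h i
    exact samePowerClass_of_rat_pow hk (hn i) (hn 0) hγ

/-! ### The integer resolvent and its size -/

/-- The tuples of `k`-th roots of `n 0, n 1, n 2, n 3` in an algebraic closure of `ℚ`. -/
noncomputable def rootTuples (k : ℕ) (n : Fin 4 → ℕ) : Finset (Fin 4 → AlgebraicClosure ℚ) :=
  Fintype.piFinset fun i => Polynomial.nthRootsFinset k (n i : AlgebraicClosure ℚ)

theorem mem_rootTuples {k : ℕ} (hk : 0 < k) {n : Fin 4 → ℕ} {x : Fin 4 → AlgebraicClosure ℚ} :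
    x ∈ rootTuples k n ↔ ∀ i, x i ^ k = n i := by
  simp [rootTuples, Polynomial.mem_nthRootsFinset hk]

theorem card_nthRootsFinset_le {R : Type*} [CommRing R] [IsDomain R] (k : ℕ) (a : R) :
    (Polynomial.nthRootsFinset k a).card ≤ k := by
  classical
  rw [Polynomial.nthRootsFinset_def]
  exact (Multiset.toFinset_card_le _).trans (Polynomial.card_nthRoots _ _)

theorem card_rootTuples_le (k : ℕ) (n : Fin 4 → ℕ) : (rootTuples k n).card ≤ k ^ 4 := by
  rw [rootTuples, Fintype.card_piFinset]
  exact (Finset.prod_le_pow_card _ _ k fun i _ => card_nthRootsFinset_le _ _).trans (by simp)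

/-- The product of all the values of `x₀ + x₁ - x₂ - x₃` with `x_i ^ k = n_i`. -/
noncomputable def radicalResolvent (k : ℕ) (n : Fin 4 → ℕ) : AlgebraicClosure ℚ :=
  ∏ x ∈ rootTuples k n, (x 0 + x 1 - x 2 - x 3)

theorem isIntegral_of_pow_eq_natCast {R : Type*} [CommRing R] {k m : ℕ} (hk : 0 < k) {x : R}
    (hx : x ^ k = m) : IsIntegral ℤ x :=
  IsIntegral.of_pow hk (hx ▸ by simpa using isIntegral_algebraMap (R := ℤ) (A := R) (x := m))

theorem isIntegral_of_mem_rootTuples {k : ℕ} (hk : 0 < k) {n : Fin 4 → ℕ}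
    {x : Fin 4 → AlgebraicClosure ℚ} (hx : x ∈ rootTuples k n) :
    IsIntegral ℤ (x 0 + x 1 - x 2 - x 3) := by
  have h i := isIntegral_of_pow_eq_natCast hk ((mem_rootTuples hk).1 hx i)
  exact (((h 0).add (h 1)).sub (h 2)).sub (h 3)

/-- Galois automorphisms permute the factors, so the product is rational; it is also an algebraic
integer. -/
theorem exists_int_eq_radicalResolvent {k : ℕ} (hk : 0 < k) (n : Fin 4 → ℕ) :
    ∃ g : ℤ, (g : AlgebraicClosure ℚ) = radicalResolvent k n := by
  obtain ⟨r, hr⟩ : radicalResolvent k n ∈ Set.range (algebraMap ℚ (AlgebraicClosure ℚ)) := by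
    rw [InfiniteGalois.mem_range_algebraMap_iff_fixed]
    intro σ
    have hmem : ∀ (σ : Gal(AlgebraicClosure ℚ/ℚ)), ∀ x ∈ rootTuples k n,
        (fun i => σ (x i)) ∈ rootTuples k n := by
      intro σ x hx
      rw [mem_rootTuples hk] at hx ⊢
      intro i
      rw [← map_pow, hx, map_natCast]
    rw [radicalResolvent, map_prod]
    refine Finset.prod_bij' (fun x _ i => σ (x i)) (fun x _ i => σ⁻¹ (x i)) (hmem σ) (hmem σ⁻¹)
      ?_ ?_ ?_
    · intro x _; funext i; exact σ.symm_apply_apply _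
    · intro x _; funext i; exact σ.apply_symm_apply _
    · intro x _; simp
  have hint : IsIntegral ℤ r := by
    rw [← isIntegral_algebraMap_iff (algebraMap ℚ (AlgebraicClosure ℚ)).injective, hr]
    exact IsIntegral.prod _ fun x hx => isIntegral_of_mem_rootTuples hk hx
  obtain ⟨g, hg⟩ := IsIntegrallyClosed.isIntegral_iff.1 hint
  exact ⟨g, by rw [← hr, ← hg]; simp⟩

/-- `radicalResolvent` as an integer. -/
noncomputable def intResolvent {k : ℕ} (hk : 0 < k) (n : Fin 4 → ℕ) : ℤ :=
  (exists_int_eq_radicalResolvent hk n).choose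

theorem cast_intResolvent {k : ℕ} (hk : 0 < k) (n : Fin 4 → ℕ) :
    (intResolvent hk n : AlgebraicClosure ℚ) = radicalResolvent k n :=
  (exists_int_eq_radicalResolvent hk n).choose_spec

theorem radicands_of_intResolvent_eq_zero {k : ℕ} (hk : 0 < k) {n : Fin 4 → ℕ}
    (hn : ∀ i, n i ≠ 0) (h : intResolvent hk n = 0) :
    (n 0 = n 1 ∧ n 2 = n 3) ∨ (n 0 = n 2 ∧ n 1 = n 3) ∨ (n 0 = n 3 ∧ n 1 = n 2) ∨
      ∀ i, SamePowerClass (reducedExponent k) (n i) (n 0) := by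
  have h0 := cast_intResolvent hk n
  rw [h, Int.cast_zero, radicalResolvent, eq_comm, Finset.prod_eq_zero_iff] at h0
  obtain ⟨x, hx, h0⟩ := h0
  exact radicands_of_sum_eq_zero hk n hn x ((mem_rootTuples hk).1 hx) h0

theorem abs_intResolvent_le {k N : ℕ} (hk : 0 < k) (hN : 1 ≤ N) {n : Fin 4 → ℕ}
    (hn : ∀ i, n i ≤ N) : |intResolvent hk n| ≤ (4 * N : ℤ) ^ k ^ 4 := by
  let φ : AlgebraicClosure ℚ →ₐ[ℚ] ℂ := IsAlgClosed.lift
  have hN1 : (1 : ℝ) ≤ N := by exact_mod_cast hN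
  have key : ‖φ (radicalResolvent k n)‖ ≤ (4 * N : ℝ) ^ k ^ 4 := by
    rw [radicalResolvent, map_prod, norm_prod]
    calc _ ≤ ∏ x ∈ rootTuples k n, (4 * N : ℝ) := by
          refine Finset.prod_le_prod (fun _ _ => norm_nonneg _) fun x hx => ?_
          have hx i : ‖φ (x i)‖ ≤ N := by
            have h1 : ‖φ (x i)‖ ^ k = n i := by
              rw [← norm_pow, ← map_pow, (mem_rootTuples hk).1 hx i, map_natCast]; simp
            refine le_of_pow_le_pow_left₀ hk.ne' (by positivity) ?_
            rw [h1]
            exact le_trans (by exact_mod_cast hn i) (le_self_pow₀ hN1 hk.ne')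
          rw [map_sub, map_sub, map_add]
          have h1 := norm_sub_le (φ (x 0) + φ (x 1) - φ (x 2)) (φ (x 3))
          have h2 := norm_sub_le (φ (x 0) + φ (x 1)) (φ (x 2))
          have h3 := norm_add_le (φ (x 0)) (φ (x 1))
          linarith [hx 0, hx 1, hx 2, hx 3]
      _ = (4 * N : ℝ) ^ (rootTuples k n).card := by rw [Finset.prod_const]
      _ ≤ _ := pow_le_pow_right₀ (by linarith) (card_rootTuples_le k n)
  rw [← cast_intResolvent hk, map_intCast, Complex.norm_intCast] at key
  exact_mod_cast key

/-- Work modulo a prime `P` above `q` in the ring of all algebraic integers. With `l ^ k` lifting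
`j`, each `u i` is congruent to `l` times a `k`-th root of `n i`; since `l ∉ P`, it cancels and one
factor of the resolvent lies in `P`. -/
theorem dvd_intResolvent {k : ℕ} (hk : 0 < k) {q : ℕ} [Fact q.Prime] {n : Fin 4 → ℕ}
    {j : ZMod q} (hj : j ≠ 0) {u : Fin 4 → ZMod q} (hu : ∀ i, u i ^ k = j * n i)
    (hsum : u 0 + u 1 = u 2 + u 3) : (q : ℤ) ∣ intResolvent hk n := by
  classical
  set A := integralClosure ℤ (AlgebraicClosure ℚ) with hA
  have hq := Fact.out (p := q.Prime)
  have : NeZero k := ⟨hk.ne'⟩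
  have hqP : (Ideal.span {(q : ℤ)}).IsPrime := by
    rw [Ideal.span_singleton_prime (by exact_mod_cast hq.ne_zero)]
    exact Nat.prime_iff_prime_int.1 hq
  obtain ⟨P, hP, hPq⟩ := Ideal.exists_ideal_over_prime_of_isIntegral_of_isDomain (S := A)
    (Ideal.span {(q : ℤ)}) (by
      rw [(RingHom.injective_iff_ker_eq_bot _).1 (FaithfulSMul.algebraMap_injective ℤ A)]
      exact bot_le)
  have hmem : ∀ z : ℤ, (z : A) ∈ P ↔ (q : ℤ) ∣ z := by
    intro z
    rw [← Ideal.mem_span_singleton, ← hPq, Ideal.mem_comap]; simp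
  have hmem' : ∀ z : ℤ, (z : A) ∈ P ↔ (z : ZMod q) = 0 := by
    intro z; rw [hmem, ZMod.intCast_zmod_eq_zero_iff_dvd]
  have hroot : ∀ m : ℕ, ∃ z : A, z ^ k = m := by
    intro m
    obtain ⟨z, hz⟩ := IsAlgClosed.exists_pow_nat_eq (m : AlgebraicClosure ℚ) hk
    exact ⟨⟨z, isIntegral_of_pow_eq_natCast hk hz⟩, Subtype.ext (by simpa using hz)⟩
  obtain ⟨l, hl⟩ := hroot j.val
  have hlP : l ∉ P := by
    intro h
    have h1 : ((j.val : ℤ) : A) ∈ P := by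
      have := P.pow_mem_of_mem h k hk
      rw [hl] at this; exact_mod_cast this
    rw [hmem'] at h1
    simp [hj] at h1
  have hl0 : (l : AlgebraicClosure ℚ) ≠ 0 := fun h => hlP (by
    rw [show l = 0 from Subtype.ext h]; exact P.zero_mem)
  have hlift : ∀ i, ∃ x : A, x ^ k = n i ∧ ((u i).val : A) - l * x ∈ P := by
    intro i
    obtain ⟨z, hz⟩ := hroot (n i)
    obtain ⟨ξ, hξ⟩ := HasEnoughRootsOfUnity.exists_primitiveRoot (AlgebraicClosure ℚ) k
    have hξA : IsPrimitiveRoot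
        (⟨ξ, isIntegral_of_pow_eq_natCast (m := 1) hk (by simp [hξ.pow_eq_one])⟩ : A) k :=
      IsPrimitiveRoot.of_map_of_injective (f := A.val) hξ Subtype.val_injective
    have h1 : ((u i).val : A) ^ k - (l * z) ^ k ∈ P := by
      rw [mul_pow, hl, hz]
      have h2 : ((((u i).val : ℤ) ^ k - (j.val : ℤ) * n i : ℤ) : A) ∈ P := by
        rw [hmem']
        push_cast
        simp only [ZMod.natCast_val, ZMod.cast_id', id]
        rw [hu, sub_self]
      exact_mod_cast h2
    -- The difference of `k`-th powers splits over the `k`-th roots of unity, and the prime `P`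
    -- contains a factor.
    rw [hξA.pow_sub_pow_eq_prod_sub_mul _ _ hk, hP.prod_mem_iff] at h1
    obtain ⟨ζ, hζ, hP1⟩ := h1
    refine ⟨ζ * z, ?_, by rwa [mul_left_comm]⟩
    rw [mul_pow, (Polynomial.mem_nthRootsFinset hk _).1 hζ, one_mul, hz]
  choose x hx hxP using hlift
  have hlin : l * (x 0 + x 1 - x 2 - x 3) ∈ P := by
    have h1 : (((u 0).val + (u 1).val - (u 2).val - (u 3).val : ℤ) : A) ∈ P := by
      rw [hmem']
      push_cast
      simp only [ZMod.natCast_val, ZMod.cast_id', id]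
      linear_combination hsum
    push_cast at h1
    have h2 := P.sub_mem h1 (P.sub_mem (P.sub_mem (P.add_mem (hxP 0) (hxP 1)) (hxP 2)) (hxP 3))
    convert h2 using 1
    ring
  have hlin' := (hP.mem_or_mem hlin).resolve_left hlP
  have hxm : (fun i => (x i : AlgebraicClosure ℚ)) ∈ rootTuples k n := by
    rw [mem_rootTuples hk]
    intro i
    exact_mod_cast congrArg Subtype.val (hx i)
  rw [← hmem]
  have hprod : (intResolvent hk n : A) = (x 0 + x 1 - x 2 - x 3) *
      ∏ y ∈ ((rootTuples k n).erase (fun i => (x i : AlgebraicClosure ℚ))).attach,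
        (⟨y.1 0 + y.1 1 - y.1 2 - y.1 3,
          isIntegral_of_mem_rootTuples hk (Finset.mem_of_mem_erase y.2)⟩ : A) := by
    apply Subtype.ext
    have := cast_intResolvent hk n
    rw [radicalResolvent, ← Finset.mul_prod_erase _ _ hxm, ← Finset.prod_attach] at this
    push_cast
    exact this
  rw [hprod]
  exact P.mul_mem_right _ hlin'

/-! ### Counting tuples of radicands -/

/-- The tuples in `[1, N]⁴`. -/
def tupleBox (N : ℕ) : Finset (Fin 4 → ℕ) := Fintype.piFinset fun _ => Finset.Icc 1 N

theorem mem_tupleBox {N : ℕ} {n : Fin 4 → ℕ} : n ∈ tupleBox N ↔ ∀ i, 1 ≤ n i ∧ n i ≤ N := by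
  simp [tupleBox]

theorem card_tupleBox (N : ℕ) : (tupleBox N).card = N ^ 4 := by
  simp [tupleBox, Fintype.card_piFinset]

theorem intervalRootEnergy_le {k N q : ℕ} (hk : 0 < k) [Fact q.Prime] {j : ZMod q} (hj : j ≠ 0) :
    intervalRootEnergy k N q j ≤
      k ^ 4 * ((tupleBox N).filter fun n => (q : ℤ) ∣ intResolvent hk n).card := by
  classical
  set T := (tupleBox N).filter fun n => (q : ℤ) ∣ intResolvent hk n
  let R : (Fin 4 → ℕ) → Finset (ZMod q × ZMod q × ZMod q × ZMod q) := fun n =>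
    (Fintype.piFinset fun i => Polynomial.nthRootsFinset k (j * (n i : ZMod q))).image
      fun u : Fin 4 → ZMod q => (u 0, u 1, u 2, u 3)
  have hR : ∀ n ∈ T, (R n).card ≤ k ^ 4 := fun n _ => by
    refine Finset.card_image_le.trans ?_
    rw [Fintype.card_piFinset]
    exact (Finset.prod_le_pow_card _ _ k fun i _ => card_nthRootsFinset_le _ _).trans (by simp)
  rw [mul_comm]
  refine le_trans ?_ (Finset.card_biUnion_le_card_mul T R _ hR)
  rw [intervalRootEnergy, rootEnergy, ← Set.ncard_coe_finset]
  refine Set.ncard_le_ncard ?_ (Finset.finite_toSet _)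
  rintro ⟨u, v, x, y⟩ ⟨hsum, ⟨a, ha1, haN, ha⟩, ⟨b, hb1, hbN, hb⟩, ⟨c, hc1, hcN, hc⟩,
    ⟨d, hd1, hdN, hd⟩⟩
  have hpow : ∀ i, (![u, v, x, y] : Fin 4 → ZMod q) i ^ k =
      j * ((![a, b, c, d] : Fin 4 → ℕ) i : ZMod q) := by
    intro i; fin_cases i <;> assumption
  rw [Finset.mem_coe, Finset.mem_biUnion]
  refine ⟨![a, b, c, d], Finset.mem_filter.2 ⟨mem_tupleBox.2 ?_,
    dvd_intResolvent hk hj hpow hsum⟩, Finset.mem_image.2 ⟨![u, v, x, y], ?_, rfl⟩⟩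
  · intro i; fin_cases i <;> constructor <;> assumption
  · rw [Fintype.mem_piFinset]
    intro i
    rw [Polynomial.mem_nthRootsFinset hk]
    exact hpow i

theorem maxIntervalRootEnergy_le {k N q : ℕ} (hk : 0 < k) (hq : q.Prime) :
    maxIntervalRootEnergy k N q ≤
      k ^ 4 * ((tupleBox N).filter fun n => (q : ℤ) ∣ intResolvent hk n).card := by
  have := Fact.mk hq
  exact ciSup_le' fun j => intervalRootEnergy_le hk j.ne_zero

theorem exists_pow_mul_of_samePowerClass (l N : ℕ) {n : Fin 4 → ℕ} (hn : n ∈ tupleBox N)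
    (h : ∀ i, SamePowerClass l (n i) (n 0)) :
    ∃ (m : ℕ) (b : Fin 4 → ℕ), ∀ i, n i = b i ^ l * m := by
  refine ⟨∏ p ∈ Finset.range (N + 1), p ^ ((n 0).factorization p % l),
    fun i => ∏ p ∈ Finset.range (N + 1), p ^ ((n i).factorization p / l), fun i => ?_⟩
  obtain ⟨h1, hN⟩ := mem_tupleBox.1 hn i
  rw [← Finset.prod_pow, ← Finset.prod_mul_distrib]
  conv_lhs => rw [← Nat.prod_factorization_pow_eq_self (n := n i) (by omega)]
  rw [Finsupp.prod_of_support_subset (s := Finset.range (N + 1))]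
  · refine Finset.prod_congr rfl fun p _ => ?_
    rw [← pow_mul, ← pow_add, ← h i p, Nat.div_add_mod']
  · intro p hp
    have := Nat.le_of_mem_primeFactors hp
    rw [Finset.mem_range]; omega
  · intro p _; exact pow_zero p

theorem sum_inv_sq_Icc_le_two (N : ℕ) : ∑ m ∈ Finset.Icc 1 N, ((m : ℝ) ^ 2)⁻¹ ≤ 2 := by
  have h : ∀ N : ℕ, ∑ m ∈ Finset.Icc 1 (N + 1), ((m : ℝ) ^ 2)⁻¹ ≤ 2 - 1 / (N + 1) := by
    intro N
    induction N with
    | zero => norm_num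
    | succ M ih =>
      rw [Finset.sum_Icc_succ_top (by omega)]
      refine (add_le_add_left ih _).trans ?_
      push_cast
      rw [← sub_nonneg]
      have : (2 : ℝ) - 1 / (M + 1 + 1) - (2 - 1 / (M + 1) + ((M + 1 + 1 : ℝ) ^ 2)⁻¹) =
          1 / ((M + 1) * (M + 1 + 1) ^ 2) := by field_simp; ring
      rw [this]; positivity
  rcases N with _ | N
  · simp
  · refine (h N).trans ?_
    have : (0 : ℝ) ≤ 1 / (N + 1) := by positivity
    linarith

/-- Writing `n i = b i ^ l * m` with a common `m`, each `b i` is at most `√(N / m)` because `l ≥ 2`.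
This gives at most `(N / m) ^ 2` tuples per `m`, and `∑ 1 / m ^ 2` converges. -/
theorem card_samePowerClass_le {l : ℕ} (hl : 2 ≤ l) (N : ℕ) (S : Finset (Fin 4 → ℕ))
    (hS : S ⊆ tupleBox N) (h : ∀ n ∈ S, ∀ i, SamePowerClass l (n i) (n 0)) :
    (S.card : ℝ) ≤ 2 * N ^ 2 := by
  classical
  have hsub : S ⊆ (Finset.Icc 1 N).biUnion fun m =>
      (Fintype.piFinset fun _ : Fin 4 => Finset.Icc 1 (Nat.sqrt (N / m))).image
        fun b i => b i ^ l * m := by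
    intro n hn
    obtain ⟨m, b, hb⟩ := exists_pow_mul_of_samePowerClass l N (hS hn) (h n hn)
    have hbox := mem_tupleBox.1 (hS hn)
    have hm : 1 ≤ m := Nat.one_le_iff_ne_zero.2 fun h0 => by
      have := (hbox 0).1; rw [hb 0, h0] at this; simp at this
    have hb1 : ∀ i, 1 ≤ b i := fun i => Nat.one_le_iff_ne_zero.2 fun h0 => by
      have := (hbox i).1; rw [hb i, h0, zero_pow (by omega)] at this; simp at this
    have hle : ∀ i, b i ^ l * m ≤ N := fun i => hb i ▸ (hbox i).2
    refine Finset.mem_biUnion.2 ⟨m, Finset.mem_Icc.2 ⟨hm, ?_⟩,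
      Finset.mem_image.2 ⟨b, Fintype.mem_piFinset.2 fun i => Finset.mem_Icc.2 ⟨hb1 i, ?_⟩,
        funext fun i => (hb i).symm⟩⟩
    · exact (Nat.le_mul_of_pos_left m (pow_pos (hb1 0) l)).trans (hle 0)
    · rw [Nat.le_sqrt', Nat.le_div_iff_mul_le hm]
      exact (Nat.mul_le_mul_right m (Nat.pow_le_pow_right (hb1 i) hl)).trans (hle i)
  have hcard : S.card ≤ ∑ m ∈ Finset.Icc 1 N, (N / m) ^ 2 := by
    refine (Finset.card_le_card hsub).trans (Finset.card_biUnion_le.trans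
      (Finset.sum_le_sum fun m _ => Finset.card_image_le.trans ?_))
    simp only [Fintype.card_piFinset, Finset.prod_const, Finset.card_univ, Fintype.card_fin,
      Nat.card_Icc, Nat.add_sub_cancel]
    calc Nat.sqrt (N / m) ^ 4 = (Nat.sqrt (N / m) ^ 2) ^ 2 := by ring
      _ ≤ _ := Nat.pow_le_pow_left (Nat.sqrt_le' _) 2
  calc (S.card : ℝ) ≤ ∑ m ∈ Finset.Icc 1 N, ((N / m : ℕ) : ℝ) ^ 2 := by exact_mod_cast hcard
    _ ≤ ∑ m ∈ Finset.Icc 1 N, (N : ℝ) ^ 2 * ((m : ℝ) ^ 2)⁻¹ := by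
        refine Finset.sum_le_sum fun m _ => ?_
        rw [← div_eq_mul_inv, ← div_pow]
        exact pow_le_pow_left₀ (by positivity) Nat.cast_div_le 2
    _ ≤ (N : ℝ) ^ 2 * 2 := by
        rw [← Finset.mul_sum]
        exact mul_le_mul_of_nonneg_left (sum_inv_sq_Icc_le_two N) (by positivity)
    _ = _ := mul_comm _ _

theorem card_filter_le_sq {N : ℕ} (r : ℕ × ℕ → Fin 4 → ℕ) (P : (Fin 4 → ℕ) → Prop)
    [DecidablePred P] (s t : Fin 4) (h : ∀ n, P n → r (n s, n t) = n) :
    ((tupleBox N).filter P).card ≤ N ^ 2 := by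
  classical
  have : (tupleBox N).filter P ⊆ (Finset.Icc 1 N ×ˢ Finset.Icc 1 N).image r := by
    intro n hn
    rw [Finset.mem_filter, mem_tupleBox] at hn
    exact Finset.mem_image.2 ⟨(n s, n t), by simp [hn.1], h n hn.2⟩
  refine (Finset.card_le_card this).trans (Finset.card_image_le.trans ?_)
  simp [sq]

theorem card_intResolvent_eq_zero_le {k : ℕ} (hk : 3 ≤ k) (hk0 : 0 < k) (N : ℕ) :
    (((tupleBox N).filter fun n => intResolvent hk0 n = 0).card : ℝ) ≤ 5 * N ^ 2 := by
  classical
  set A := (tupleBox N).filter fun n => n 0 = n 1 ∧ n 2 = n 3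
  set B := (tupleBox N).filter fun n => n 0 = n 2 ∧ n 1 = n 3
  set C := (tupleBox N).filter fun n => n 0 = n 3 ∧ n 1 = n 2
  set S := (tupleBox N).filter fun n => ∀ i, SamePowerClass (reducedExponent k) (n i) (n 0)
  have hsub : ((tupleBox N).filter fun n => intResolvent hk0 n = 0) ⊆ A ∪ B ∪ C ∪ S := by
    intro n hn
    rw [Finset.mem_filter] at hn
    have hn0 : ∀ i, n i ≠ 0 := fun i => by have := mem_tupleBox.1 hn.1 i; omega
    simp only [A, B, C, S, Finset.mem_union, Finset.mem_filter, hn.1, true_and]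
    have := radicands_of_intResolvent_eq_zero hk0 hn0 hn.2
    tauto
  have hA : A.card ≤ N ^ 2 := card_filter_le_sq (fun p => ![p.1, p.1, p.2, p.2]) _ 0 2
    fun n hn => by funext i; fin_cases i <;> simp [hn.1, hn.2]
  have hB : B.card ≤ N ^ 2 := card_filter_le_sq (fun p => ![p.1, p.2, p.1, p.2]) _ 0 1
    fun n hn => by funext i; fin_cases i <;> simp [hn.1, hn.2]
  have hC : C.card ≤ N ^ 2 := card_filter_le_sq (fun p => ![p.1, p.2, p.2, p.1]) _ 0 1
    fun n hn => by funext i; fin_cases i <;> simp [hn.1, hn.2]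
  have hS : (S.card : ℝ) ≤ 2 * N ^ 2 := card_samePowerClass_le (two_le_reducedExponent hk) N S
    (Finset.filter_subset _ _) fun n hn => (Finset.mem_filter.1 hn).2
  have h1 := (Finset.card_le_card hsub).trans (Finset.card_union_le _ _)
  have h2 := Finset.card_union_le (A ∪ B) C
  have h3 := Finset.card_union_le A B
  have h4 : ((tupleBox N).filter fun n => intResolvent hk0 n = 0).card ≤ 3 * N ^ 2 + S.card := by
    omega
  have h5 : (((tupleBox N).filter fun n => intResolvent hk0 n = 0).card : ℝ) ≤
      3 * N ^ 2 + S.card := by exact_mod_cast h4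
  linarith

/-! ### Dyadic primes -/

theorem half_pow_card_le_prod {Q : ℕ} {D : Finset ℕ} (hD : D ⊆ dyadicPrimes Q) :
    ((Q : ℝ) / 2) ^ D.card ≤ ((∏ q ∈ D, q : ℕ) : ℝ) := by
  rw [← Finset.prod_const, Nat.cast_prod]
  refine Finset.prod_le_prod (fun _ _ => by positivity) fun q hq => ?_
  have h := (Finset.mem_filter.1 (hD hq)).2.2
  rw [div_le_iff₀ two_pos, mul_comm]
  exact_mod_cast h

theorem prime_of_mem_dyadicPrimes {Q q : ℕ} (hq : q ∈ dyadicPrimes Q) : q.Prime :=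
  (Finset.mem_filter.1 hq).2.1

theorem card_dyadicPrimes_dvd_le {Q K : ℕ} {g : ℤ} (hg : g ≠ 0) (hgQ : |g| ≤ (4 * Q : ℤ) ^ K) :
    ((dyadicPrimes Q).filter fun q : ℕ => (q : ℤ) ∣ g).card ≤ 2 * K + 16 := by
  set D := (dyadicPrimes Q).filter fun q : ℕ => (q : ℤ) ∣ g with hD
  have hDsub : D ⊆ dyadicPrimes Q := Finset.filter_subset _ _
  rcases lt_or_ge Q 16 with hQ | hQ
  · have : D.card ≤ (Finset.range Q).card :=
      Finset.card_le_card (hDsub.trans (Finset.filter_subset _ _))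
    rw [Finset.card_range] at this
    omega
  have hdvd : ∏ q ∈ D, q ∣ g.natAbs := Finset.prod_primes_dvd _
    (fun q hq => (prime_of_mem_dyadicPrimes (hDsub hq)).prime)
    (fun q hq => Int.natCast_dvd.1 (Finset.mem_filter.1 hq).2)
  have hle := Nat.le_of_dvd (Int.natAbs_pos.2 hg) hdvd
  have hQ' : (16 : ℝ) ≤ Q := by exact_mod_cast hQ
  have h1 : ((Q : ℝ) / 2) ^ D.card ≤ ((Q : ℝ) / 2) ^ (2 * K) := by
    calc ((Q : ℝ) / 2) ^ D.card ≤ ((∏ q ∈ D, q : ℕ) : ℝ) := half_pow_card_le_prod hDsub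
      _ ≤ (g.natAbs : ℝ) := by exact_mod_cast hle
      _ = ((|g| : ℤ) : ℝ) := by rw [Nat.cast_natAbs]
      _ ≤ (4 * Q : ℝ) ^ K := by exact_mod_cast hgQ
      -- `4 * Q ≤ (Q / 2) ^ 2` is exactly where `Q ≥ 16` is needed.
      _ ≤ (((Q : ℝ) / 2) ^ 2) ^ K := pow_le_pow_left₀ (by positivity) (by nlinarith) K
      _ = _ := (pow_mul _ _ _).symm
  have := (pow_le_pow_iff_right₀ (by linarith)).1 h1
  omega

/-- Chebyshev's upper bound, from `primorial Q ≤ 4 ^ Q`; for `Q ≥ 4`, `log (Q / 2)` is at least half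
of `log Q`. -/
theorem card_dyadicPrimes_mul_log_le (Q : ℕ) :
    ((dyadicPrimes Q).card : ℝ) * Real.log Q ≤ 4 * Q := by
  rcases Nat.eq_zero_or_pos Q with rfl | hQ0
  · simp
  have hQ0' : (0 : ℝ) < Q := by exact_mod_cast hQ0
  rcases lt_or_ge Q 4 with hQ | hQ
  · have h1 : (dyadicPrimes Q).card ≤ Q :=
      (Finset.card_filter_le _ _).trans (Finset.card_range Q).le
    have h2 : ((dyadicPrimes Q).card : ℝ) ≤ Q := by exact_mod_cast h1
    have h3 : (Q : ℝ) ≤ 4 := by exact_mod_cast hQ.le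
    have h4 := Real.log_le_sub_one_of_pos hQ0'
    have h5 : Real.log Q ≤ 4 := by linarith
    have h6 : 0 ≤ Real.log Q := Real.log_natCast_nonneg Q
    nlinarith
  · have hQ' : (4 : ℝ) ≤ Q := by exact_mod_cast hQ
    have hdvd : ∏ q ∈ dyadicPrimes Q, q ∣ primorial Q := Finset.prod_primes_dvd _
      (fun q hq => (prime_of_mem_dyadicPrimes hq).prime) fun q hq =>
        (prime_of_mem_dyadicPrimes hq).dvd_primorial_iff.2
          (Finset.mem_range.1 (Finset.mem_filter.1 hq).1).le
    have hle : ∏ q ∈ dyadicPrimes Q, q ≤ 4 ^ Q :=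
      (Nat.le_of_dvd (primorial_pos Q) hdvd).trans (primorial_le_four_pow Q)
    have h1 : ((Q : ℝ) / 2) ^ (dyadicPrimes Q).card ≤ (4 : ℝ) ^ Q :=
      (half_pow_card_le_prod subset_rfl).trans (by exact_mod_cast hle)
    have h2 := Real.log_le_log (by positivity) h1
    rw [Real.log_pow, Real.log_pow, Real.log_div (by positivity) two_ne_zero] at h2
    have h4 : Real.log 4 = 2 * Real.log 2 := by
      rw [show (4 : ℝ) = 2 ^ 2 by norm_num, Real.log_pow]; norm_num
    have h5 : Real.log 4 ≤ Real.log Q := Real.log_le_log (by norm_num) hQ'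
    have h6 : Real.log 2 ≤ 1 := by linarith [Real.log_two_lt_d9]
    have hc : (0 : ℝ) ≤ (dyadicPrimes Q).card := by positivity
    have h7 := mul_nonneg hc (sub_nonneg.2 h5)
    rw [h4] at h2 h7
    nlinarith

/-! ### Double counting and the final bound -/

theorem sum_maxIntervalRootEnergy_le {k : ℕ} (hk : 3 ≤ k) {N Q : ℕ} (hN : 1 ≤ N) (hNQ : N ≤ Q) :
    ∑ q ∈ dyadicPrimes Q, (maxIntervalRootEnergy k N q : ℝ) ≤
      k ^ 4 * ((2 * k ^ 4 + 16) * N ^ 4 + (dyadicPrimes Q).card * (5 * N ^ 2)) := by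
  classical
  have hk0 : 0 < k := by omega
  set D := dyadicPrimes Q
  set Z := (tupleBox N).filter fun n => intResolvent hk0 n = 0
  have hpt : ∀ n ∈ tupleBox N, (D.filter fun q : ℕ => (q : ℤ) ∣ intResolvent hk0 n).card ≤
      (2 * k ^ 4 + 16) + if intResolvent hk0 n = 0 then D.card else 0 := by
    intro n hn
    split_ifs with h0
    · exact (Finset.card_filter_le _ _).trans (Nat.le_add_left _ _)
    · refine card_dyadicPrimes_dvd_le h0
        ((abs_intResolvent_le hk0 hN fun i => (mem_tupleBox.1 hn i).2).trans ?_)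
      gcongr
  have hnat : ∑ q ∈ D, maxIntervalRootEnergy k N q ≤
      k ^ 4 * ((2 * k ^ 4 + 16) * N ^ 4 + D.card * Z.card) := by
    calc ∑ q ∈ D, maxIntervalRootEnergy k N q
        ≤ ∑ q ∈ D, k ^ 4 * ((tupleBox N).filter fun n => (q : ℤ) ∣ intResolvent hk0 n).card :=
          Finset.sum_le_sum fun q hq =>
            maxIntervalRootEnergy_le hk0 (prime_of_mem_dyadicPrimes hq)
      _ = k ^ 4 * ∑ n ∈ tupleBox N,
          (D.filter fun q : ℕ => (q : ℤ) ∣ intResolvent hk0 n).card := by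
        rw [← Finset.mul_sum]
        congr 1
        exact Finset.sum_card_bipartiteAbove_eq_sum_card_bipartiteBelow
          fun (q : ℕ) n => (q : ℤ) ∣ intResolvent hk0 n
      _ ≤ k ^ 4 * ∑ n ∈ tupleBox N,
          ((2 * k ^ 4 + 16) + if intResolvent hk0 n = 0 then D.card else 0) :=
        Nat.mul_le_mul_left _ (Finset.sum_le_sum hpt)
      _ = _ := by
        rw [Finset.sum_add_distrib, Finset.sum_const, card_tupleBox, ← Finset.sum_filter,
          Finset.sum_const, smul_eq_mul, smul_eq_mul, mul_comm (N ^ 4), mul_comm Z.card]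
  calc ∑ q ∈ D, (maxIntervalRootEnergy k N q : ℝ)
      ≤ k ^ 4 * ((2 * k ^ 4 + 16) * N ^ 4 + D.card * Z.card) := by exact_mod_cast hnat
    _ ≤ _ := by
      gcongr
      exact card_intResolvent_eq_zero_le hk hk0 N

theorem tendsto_log_log_div_log :
    Tendsto (fun Q : ℕ => Real.log (Real.log Q) / Real.log Q) atTop (𝓝 0) := by
  have h : Tendsto (fun x : ℝ => Real.log x / x) atTop (𝓝 0) :=
    Real.isLittleO_log_id_atTop.tendsto_div_nhds_zero
  exact h.comp (Real.tendsto_log_atTop.comp tendsto_natCast_atTop_atTop)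

theorem log_div_le_rpow {Q : ℕ} (hQ : 1 ≤ Q) :
    Real.log Q / Q ≤ (Q : ℝ) ^ (-1 + Real.log (Real.log Q) / Real.log Q) := by
  have hQ0 : (0 : ℝ) < Q := by exact_mod_cast hQ
  rcases (Real.log_natCast_nonneg Q).eq_or_lt with h | h
  -- For `Q = 1` the left side is zero; otherwise equality holds.
  · rw [← h, zero_div]; positivity
  · refine le_of_eq ?_
    rw [Real.rpow_add hQ0, Real.rpow_neg_one, Real.rpow_def_of_pos hQ0, mul_div_cancel₀ _ h.ne',
      Real.exp_log h, div_eq_inv_mul]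

theorem theorem1p3 (k : ℕ) (hk : 3 ≤ k) :
    ∃ C : ℝ, 0 < C ∧ ∃ δ : ℕ → ℝ, Tendsto δ atTop (𝓝 0) ∧
      ∀ Q N : ℕ, 1 ≤ N → N ≤ Q →
        Real.log (Q : ℝ) / (Q : ℝ) *
            ∑ q ∈ dyadicPrimes Q, (maxIntervalRootEnergy k N q : ℝ) ≤
          C * ((N : ℝ) ^ 2 + (N : ℝ) ^ 4 * (Q : ℝ) ^ (-1 + δ Q)) := by
  refine ⟨(k : ℝ) ^ 4 * (2 * (k : ℝ) ^ 4 + 36), by positivity,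
    fun Q => Real.log (Real.log Q) / Real.log Q, tendsto_log_log_div_log, fun Q N hN hNQ => ?_⟩
  have hQ : 1 ≤ Q := hN.trans hNQ
  have hQ0 : (0 : ℝ) < Q := by exact_mod_cast hQ
  set X := (Q : ℝ) ^ (-1 + Real.log (Real.log Q) / Real.log Q)
  have hX : Real.log Q / Q ≤ X := log_div_le_rpow hQ
  have hL : 0 ≤ Real.log Q / Q := div_nonneg (Real.log_natCast_nonneg Q) hQ0.le
  have hD : Real.log Q / Q * (dyadicPrimes Q).card ≤ 4 := by
    rw [div_mul_eq_mul_div, div_le_iff₀ hQ0, mul_comm (Real.log _)]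
    exact card_dyadicPrimes_mul_log_le Q
  have hX0 : 0 ≤ X := hL.trans hX
  calc Real.log Q / Q * ∑ q ∈ dyadicPrimes Q, (maxIntervalRootEnergy k N q : ℝ)
      ≤ Real.log Q / Q *
        (k ^ 4 * ((2 * k ^ 4 + 16) * N ^ 4 + (dyadicPrimes Q).card * (5 * N ^ 2))) :=
        mul_le_mul_of_nonneg_left (sum_maxIntervalRootEnergy_le hk hN hNQ) hL
    _ = k ^ 4 * ((2 * k ^ 4 + 16) * N ^ 4 * (Real.log Q / Q) +
          Real.log Q / Q * (dyadicPrimes Q).card * (5 * N ^ 2)) := by ring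
    _ ≤ k ^ 4 * ((2 * k ^ 4 + 16) * N ^ 4 * X + 4 * (5 * N ^ 2)) := by gcongr
    _ ≤ k ^ 4 * (2 * k ^ 4 + 36) * (N ^ 2 + N ^ 4 * X) := by
      rw [mul_assoc ((k : ℝ) ^ 4)]
      refine mul_le_mul_of_nonneg_left ?_ (by positivity)
      have h1 : 0 ≤ (N : ℝ) ^ 4 * X := by positivity
      have h2 : 0 ≤ (k : ℝ) ^ 4 * (N : ℝ) ^ 2 := by positivity
      nlinarith
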